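/- For positive integers $i_1,\dots,i_k$ with $i_1>1$ let \[ \zeta(i_1,\dots,i_k)=\sum_{n_1>\dots>n_k\ge 1}\frac1{n_1^{i_1}\cdots n_k^{i_k}} \] be the multiple zeta value of weight $i_1+\dots+i_k$ and depth $k$, and let \[ E(2n,k)=\sum_{\substack{i_1,\dots,i_k\ge 2\text{ even}\\ i_1+\dots+i_k=2n}}\zeta(i_1,\dots,i_k) \] be the (finite) sum of all multiple zeta values with even arguments, weight $2n$ and depth $k$. Let $\zeta(s)$ be the Riemann zeta function and $B_m$ the $m$th Bernoulli number. Then for all integers $1\le k\le n$ every series $\zeta(i_1,\dots,i_k)$ occurring in $E(2n,k)$ converges, and \[ E(2n,k)=\frac1{2^{2(k-1)}}\binom{2k-1}{k}\zeta(2n)-\sum_{j=1}^{\lfloor\frac{k-1}2\rfloor}\frac1{2^{2k-3}(2j+1)B_{2j}}\binom{2k-2j-1}{k}\zeta(2j)\zeta(2n-2j). \] -/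

import Mathlib

/-- The index set of the multiple zeta series of depth `k`: the tuples of natural numbers
`m 0 > m 1 > ⋯ > m (k - 1) ≥ 1`. -/
abbrev MZVIndex (k : ℕ) : Type :=
  {m : Fin k → ℕ // StrictAnti m ∧ ∀ j, 1 ≤ m j}

/-- The general term `1 / (m 0 ^ i 0 * ⋯ * m (k - 1) ^ i (k - 1))` of the multiple zeta series. -/
noncomputable def mzvTerm {k : ℕ} (i : Fin k → ℕ) (m : MZVIndex k) : ℝ :=
  1 / ∏ j, (m.1 j : ℝ) ^ i j

/-- The multiple zeta value `ζ(i 0, …, i (k - 1))`, of depth `k` and weight `∑ j, i j`. -/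
noncomputable def multipleZeta {k : ℕ} (i : Fin k → ℕ) : ℝ :=
  ∑' m : MZVIndex k, mzvTerm i m

/-- The `k`-tuples of positive even integers with sum `w`. -/
def evenArguments (w k : ℕ) : Finset (Fin k → ℕ) :=
  (Finset.Nat.antidiagonalTuple k w).filter fun i => ∀ j, 0 < i j ∧ Even (i j)

/-- `E(w, k)`: the sum of all multiple zeta values of even arguments, weight `w` and depth `k`. -/
noncomputable def evenMZVSum (w k : ℕ) : ℝ :=
  ∑ i ∈ evenArguments w k, multipleZeta i

/-!
Write `g m = X / (m ^ 2 - X) = ∑_{n ≥ 1} X ^ n / m ^ (2 n)`. The generating function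
`E_k = ∑_n E(2 n, k) X ^ n` is the `k`-th elementary symmetric function of the `g m`, so that
multiplying `∑_k t ^ k E_k = ∏_m (1 + t g m)` by `P = ∏_m (1 - X / m ^ 2)` gives `P((1 - t) X)`;
comparing coefficients, `X ^ n` has coefficient `(-1) ^ k (n choose k) p_n` in `E_k P` when it has
coefficient `p_n` in `P`. For the products over `m ≤ N` this is an identity of formal power series.
By Euler's product for the sine, `P` tends to `sin (π √X) / (π √X)` as `N → ∞`; the coefficients
converge too, because they are bounded uniformly in `N`.

The differential equation of this limit becomes the three-term recurrence in the depth
`(k + 2) (k + 1) E_{k + 2} = (k + 3 / 2) (k + 1) E_{k + 1} - (π ^ 2 / 4) X E_k`.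
It expresses `E(2 n, k)` as a combination of the numbers `E(2 n - 2 j, 1) = ζ(2 n - 2 j)`, whose
coefficients are binomial multiples of powers of `π`, and Euler's formula for `ζ(2 j)` puts these
in the form of the theorem.
-/

open Filter Finset PowerSeries Topology

section GeometricTail

variable {R ι : Type*} [CommRing R]

/-- The geometric series without constant term, `c X / (1 - c X) = ∑_{n ≥ 1} c ^ n X ^ n`. For
`c = m⁻²` it is the generating function, with one power of `X` for every two units of weight, of
the even powers of `1 / m` in a multiple zeta series. -/
noncomputable def geomTail (c : R) : R⟦X⟧ :=
  PowerSeries.mk fun n => if n = 0 then 0 else c ^ n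

theorem coeff_geomTail (c : R) (n : ℕ) : coeff n (geomTail c) = if n = 0 then 0 else c ^ n :=
  coeff_mk n _

theorem geomTail_mul_one_sub (c : R) : geomTail c * (1 - C c * X) = C c * X := by
  ext n
  rw [mul_sub, mul_one, mul_left_comm, map_sub, coeff_C_mul, coeff_C_mul]
  rcases n with _ | _ | n
  · simp [coeff_geomTail]
  · simp [coeff_geomTail, coeff_succ_mul_X]
  · simp [coeff_geomTail, coeff_succ_mul_X, coeff_X, pow_succ']

theorem map_geomTail {S : Type*} [CommRing S] (f : R →+* S) (c : R) :
    PowerSeries.map f (geomTail c) = geomTail (f c) := by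
  ext n
  simp only [coeff_map, coeff_geomTail]
  split_ifs <;> simp

theorem rescale_prod_one_sub (a : R) (s : Finset ι) (c : ι → R) :
    rescale a (∏ i ∈ s, (1 - C (c i) * X)) = ∏ i ∈ s, (1 - C (c i) * (C a * X)) := by
  have hC (b : R) : rescale a (C b) = C b := by
    ext n
    rcases n with _ | n <;> simp [coeff_C]
  simp only [map_prod, map_sub, map_one, map_mul, rescale_X, hC]

theorem prod_one_add_geomTail_mul (t : R) (s : Finset ι) (c : ι → R) :
    (∏ i ∈ s, (1 + C t * geomTail (c i))) * ∏ i ∈ s, (1 - C (c i) * X) =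
      rescale (1 - t) (∏ i ∈ s, (1 - C (c i) * X)) := by
  rw [rescale_prod_one_sub, ← prod_mul_distrib]
  refine prod_congr rfl fun i _ => ?_
  rw [map_sub, map_one]
  linear_combination C t * geomTail_mul_one_sub (c i)

theorem sum_powerset_pow_card_mul_coeff (t : R) (s : Finset ι) (c : ι → R) (n : ℕ) :
    ∑ T ∈ s.powerset,
        t ^ #T * coeff n ((∏ i ∈ T, geomTail (c i)) * ∏ i ∈ s, (1 - C (c i) * X)) =
      (1 - t) ^ n * coeff n (∏ i ∈ s, (1 - C (c i) * X)) := by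
  rw [← coeff_rescale, ← prod_one_add_geomTail_mul, prod_one_add, sum_mul, map_sum]
  refine sum_congr rfl fun T _ => ?_
  rw [prod_mul_distrib, prod_const, ← map_pow, mul_assoc, coeff_C_mul]

theorem coeff_sum_powersetCard_prod_geomTail_mul (s : Finset ι) (c : ι → R) (k n : ℕ) :
    coeff n ((∑ T ∈ s.powersetCard k, ∏ i ∈ T, geomTail (c i)) * ∏ i ∈ s, (1 - C (c i) * X)) =
      (-1) ^ k * (n.choose k : R) * coeff n (∏ i ∈ s, (1 - C (c i) * X)) := by
  -- Up to the sign `(-1) ^ k`, these are the coefficients of `t ^ k` in the previous identity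
  -- for the scalar `-t` of the polynomial ring `R[t]`.
  have h := congrArg (Polynomial.coeff · k)
    (sum_powerset_pow_card_mul_coeff (-Polynomial.X) s (fun i => Polynomial.C (c i)) n)
  have hP : coeff n (∏ i ∈ s, (1 - C (Polynomial.C (c i)) * X)) =
      Polynomial.C (coeff n (∏ i ∈ s, (1 - C (c i) * X))) := by
    simp [← coeff_map, map_prod]
  have hT (T : Finset ι) :
      coeff n ((∏ i ∈ T, geomTail (Polynomial.C (c i))) *
          ∏ i ∈ s, (1 - C (Polynomial.C (c i)) * X)) =
        Polynomial.C (coeff n ((∏ i ∈ T, geomTail (c i)) * ∏ i ∈ s, (1 - C (c i) * X))) := by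
    simp [← coeff_map, map_prod, map_geomTail]
  have hX (m : ℕ) : ((-Polynomial.X) ^ m : Polynomial R).coeff k =
      if m = k then (-1) ^ k else 0 := by
    rw [← neg_one_mul, mul_pow, ← map_one Polynomial.C, ← map_neg, ← map_pow,
      Polynomial.coeff_C_mul_X_pow]
    rcases eq_or_ne k m with rfl | h
    · simp
    · simp [h, h.symm]
  simp only [hP, hT, hX, sub_neg_eq_add, Polynomial.finsetSum_coeff, Polynomial.coeff_mul_C,
    Polynomial.coeff_one_add_X_pow, ite_mul, zero_mul, ← sum_filter, ← powersetCard_eq_filter,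
    ← mul_sum] at h
  rw [mul_assoc, ← h, ← mul_assoc, ← mul_pow, neg_one_mul, neg_neg, one_pow, one_mul, sum_mul,
    map_sum]

end GeometricTail

section Truncation

theorem coeff_prod_fin {R : Type*} [CommSemiring R] {k : ℕ} (f : Fin k → R⟦X⟧) (n : ℕ) :
    coeff n (∏ j, f j) = ∑ l ∈ Finset.Nat.antidiagonalTuple k n, ∏ j, coeff (l j) (f j) := by
  rw [coeff_prod]
  refine sum_equiv Finsupp.equivFunOnFinite (fun l => ?_) fun l _ => rfl
  simp [mem_finsuppAntidiag, Finset.Nat.mem_antidiagonalTuple]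

theorem evenArguments_two_mul (n k : ℕ) :
    evenArguments (2 * n) k =
      ((Finset.Nat.antidiagonalTuple k n).filter fun l => ∀ j, l j ≠ 0).image
        fun l j => 2 * l j := by
  ext i
  simp only [evenArguments, mem_filter, mem_image, Finset.Nat.mem_antidiagonalTuple]
  constructor
  · rintro ⟨hsum, hi⟩
    choose l hl using fun j => even_iff_two_dvd.1 (hi j).2
    obtain rfl : i = fun j => 2 * l j := funext hl
    rw [← mul_sum] at hsum
    exact ⟨l, ⟨by lia, fun j => by have := (hi j).1; lia⟩, rfl⟩
  · rintro ⟨l, ⟨hsum, hl⟩, rfl⟩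
    exact ⟨by rw [← mul_sum, hsum], fun j => ⟨by have := hl j; lia, even_two_mul _⟩⟩

theorem coeff_prod_geomTail_sq {R : Type*} [CommRing R] {k : ℕ} (c : Fin k → R) (n : ℕ) :
    coeff n (∏ j, geomTail (c j ^ 2)) = ∑ i ∈ evenArguments (2 * n) k, ∏ j, c j ^ i j := by
  have hinj : Function.Injective fun (l : Fin k → ℕ) j => 2 * l j := fun l l' h =>
    funext fun j => Nat.eq_of_mul_eq_mul_left two_pos (congrFun h j)
  rw [coeff_prod_fin, evenArguments_two_mul, sum_image hinj.injOn, sum_filter]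
  refine sum_congr rfl fun l _ => ?_
  split_ifs with hl
  · simp only [coeff_geomTail, hl, if_false, pow_mul]
  · obtain ⟨j, hj⟩ := not_forall_not.1 hl
    exact prod_eq_zero (mem_univ j) (by simp [coeff_geomTail, hj])

/-- The indices of the multiple zeta series of depth `k` whose entries are at most `N`. They
exhaust all indices as `N → ∞`, and are the `k`-element subsets of `{1, …, N}`. -/
noncomputable def boundedMZVIndex (k N : ℕ) : Finset (MZVIndex k) :=
  haveI := Classical.decPred fun m : Fin k → ℕ => StrictAnti m ∧ ∀ j, 1 ≤ m j
  (Fintype.piFinset fun _ => range (N + 1)).subtype _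

theorem mem_boundedMZVIndex {k N : ℕ} {m : MZVIndex k} :
    m ∈ boundedMZVIndex k N ↔ ∀ j, m.1 j ≤ N := by
  simp [boundedMZVIndex]

theorem tendsto_boundedMZVIndex (k : ℕ) : Tendsto (boundedMZVIndex k) atTop atTop := by
  refine tendsto_atTop_finset_of_monotone (fun M N h m hm => ?_) fun m => ?_
  · exact mem_boundedMZVIndex.2 fun j => (mem_boundedMZVIndex.1 hm j).trans h
  · exact ⟨univ.sup m.1, mem_boundedMZVIndex.2 fun j => le_sup (f := m.1) (mem_univ j)⟩

theorem sum_boundedMZVIndex_prod {R : Type*} [CommSemiring R] (k N : ℕ) (f : ℕ → R) :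
    ∑ m ∈ boundedMZVIndex k N, ∏ j, f (m.1 j) =
      ∑ T ∈ (Icc 1 N).powersetCard k, ∏ i ∈ T, f i := by
  refine sum_bij (fun m _ => univ.image m.1) (fun m hm => ?_) (fun m _ m' _ h => ?_)
    (fun T hT => ?_) fun m _ => (prod_image m.2.1.injective.injOn).symm
  · rw [mem_powersetCard, card_image_of_injective _ m.2.1.injective, card_fin]
    exact ⟨image_subset_iff.2 fun j _ => mem_Icc.2 ⟨m.2.2 j, mem_boundedMZVIndex.1 hm j⟩, rfl⟩
  · rw [← coe_inj, coe_image, coe_image, coe_univ, Set.image_univ, Set.image_univ] at h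
    exact Subtype.ext ((m.2.1.range_inj m'.2.1).1 h)
  · obtain ⟨hsub, hcard⟩ := mem_powersetCard.1 hT
    have hmem (j : Fin k) := mem_Icc.1 (hsub (T.orderEmbOfFin_mem hcard j.rev))
    refine ⟨⟨fun j => T.orderEmbOfFin hcard j.rev,
      (T.orderEmbOfFin hcard).strictMono.comp_strictAnti Fin.rev_strictAnti, fun j => (hmem j).1⟩,
      mem_boundedMZVIndex.2 fun j => (hmem j).2, ?_⟩
    change univ.image (T.orderEmbOfFin hcard ∘ Fin.rev) = T
    rw [← image_image, image_univ_of_surjective Fin.rev_surjective, image_orderEmbOfFin_univ]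

theorem sum_evenArguments_sum_mzvTerm (n k N : ℕ) :
    ∑ i ∈ evenArguments (2 * n) k, ∑ m ∈ boundedMZVIndex k N, mzvTerm i m =
      coeff n (∑ T ∈ (Icc 1 N).powersetCard k, ∏ m ∈ T, geomTail ((m : ℝ)⁻¹ ^ 2)) := by
  rw [← sum_boundedMZVIndex_prod k N fun m => geomTail ((m : ℝ)⁻¹ ^ 2), sum_comm, map_sum]
  refine sum_congr rfl fun m _ => ?_
  rw [coeff_prod_geomTail_sq]
  simp [mzvTerm]

end Truncation

section Convergence

theorem summable_prod_fin {ι : Type*} {k : ℕ} {f : Fin k → ι → ℝ} (hf : ∀ j, Summable (f j))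
    (hf0 : ∀ j, 0 ≤ f j) : Summable fun m : Fin k → ι => ∏ j, f j (m j) := by
  induction k with
  | zero => exact Summable.of_finite
  | succ k ih =>
    rw [← (Fin.consEquiv fun _ => ι).summable_iff]
    have h := (hf 0).mul_of_nonneg (ih (fun j => hf j.succ) fun j => hf0 j.succ) (hf0 0)
      fun m => prod_nonneg fun j _ => hf0 j.succ (m j)
    simpa [Function.comp_def, Fin.prod_univ_succ] using h

theorem summable_mzvTerm {k : ℕ} {i : Fin k → ℕ} (hi : ∀ j, 1 < i j) : Summable (mzvTerm i) := by
  have h := summable_prod_fin (fun j => Real.summable_one_div_nat_pow.2 (hi j))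
    fun j m => by positivity
  exact (h.comp_injective Subtype.val_injective).congr fun m => by simp [mzvTerm]

theorem one_lt_of_mem_evenArguments {w k : ℕ} {i : Fin k → ℕ} (hi : i ∈ evenArguments w k)
    (j : Fin k) : 1 < i j := by
  obtain ⟨hpos, l, hl⟩ := (mem_filter.1 hi).2 j
  lia

theorem tendsto_evenMZVSum (n k : ℕ) :
    Tendsto (fun N : ℕ => coeff n
        (∑ T ∈ (Icc 1 N).powersetCard k, ∏ m ∈ T, geomTail ((m : ℝ)⁻¹ ^ 2)))
      atTop (𝓝 (evenMZVSum (2 * n) k)) := by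
  refine Tendsto.congr (fun N => sum_evenArguments_sum_mzvTerm n k N) ?_
  exact tendsto_finsetSum _ fun i hi =>
    (summable_mzvTerm (one_lt_of_mem_evenArguments hi)).hasSum.comp (tendsto_boundedMZVIndex k)

theorem multipleZeta_fin_one {i : Fin 1 → ℕ} (hi : 1 < i 0) :
    (multipleZeta i : ℂ) = riemannZeta (i 0) := by
  have hinj : Function.Injective fun m : MZVIndex 1 => m.1 0 := fun m m' h =>
    Subtype.ext (funext fun j => by simpa [Subsingleton.elim j 0] using h)
  have hsupp : Function.support (fun m : ℕ => 1 / (m : ℂ) ^ i 0) ⊆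
      Set.range fun m : MZVIndex 1 => m.1 0 := fun m hm =>
    ⟨⟨fun _ => m, Subsingleton.strictAnti _, fun _ => Nat.one_le_iff_ne_zero.2 fun h0 =>
      hm (by simp [h0, (zero_lt_one.trans hi).ne'])⟩, rfl⟩
  rw [zeta_nat_eq_tsum_of_gt_one hi, multipleZeta, Complex.ofReal_tsum, ← hinj.tsum_eq hsupp]
  simp [mzvTerm]

theorem evenMZVSum_one_depth {n : ℕ} (hn : n ≠ 0) :
    (evenMZVSum (2 * n) 1 : ℂ) = riemannZeta (2 * n) := by
  have h : evenArguments (2 * n) 1 = {![2 * n]} := by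
    rw [evenArguments, Finset.Nat.antidiagonalTuple_one, filter_singleton, if_pos]
    simpa using Nat.pos_of_ne_zero hn
  rw [evenMZVSum, h, sum_singleton, multipleZeta_fin_one (by simp; lia)]
  simp

theorem evenMZVSum_zero_depth {w : ℕ} (hw : w ≠ 0) : evenMZVSum w 0 = 0 := by
  refine sum_eq_zero fun i hi => absurd ?_ hw
  simpa using (Finset.Nat.mem_antidiagonalTuple.1 (mem_filter.1 hi).1).symm

end Convergence

section CoefficientConvergence

variable {E : Type*} [NormedAddCommGroup E] [NormedSpace ℝ E]

theorem norm_pow_smul_le {a : ℕ → E} {M x : ℝ} (ha : ∀ n, ‖a n‖ ≤ M) (hx : 0 ≤ x) (n : ℕ) :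
    ‖x ^ n • a n‖ ≤ x ^ n * M := by
  rw [norm_smul, norm_pow, Real.norm_of_nonneg hx]
  exact mul_le_mul_of_nonneg_left (ha n) (by positivity)

theorem norm_tsum_pow_smul_le {a : ℕ → E} {M x : ℝ} (ha : ∀ n, ‖a n‖ ≤ M) (hx0 : 0 ≤ x)
    (hx1 : x < 1) : ‖∑' n, x ^ n • a n‖ ≤ (1 - x)⁻¹ * M :=
  tsum_of_norm_bounded ((hasSum_geometric_of_lt_one hx0 hx1).mul_right M) (norm_pow_smul_le ha hx0)

variable [CompleteSpace E]

theorem tsum_pow_smul_eq_add {a : ℕ → E} {M x : ℝ} (ha : ∀ n, ‖a n‖ ≤ M) (hx0 : 0 ≤ x)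
    (hx1 : x < 1) : ∑' n, x ^ n • a n = a 0 + x • ∑' n, x ^ n • a (n + 1) := by
  have hs : Summable fun n => x ^ n • a n := .of_norm_bounded
    ((summable_geometric_of_lt_one hx0 hx1).mul_right M) (norm_pow_smul_le ha hx0)
  rw [hs.tsum_eq_zero_add, pow_zero, one_smul, ← tsum_const_smul'']
  simp only [pow_succ', mul_smul]

variable {ι : Type*} {l : Filter ι} {a : ι → ℕ → E} {M : ℝ}

theorem tendsto_zero_coeff_zero_of_tendsto_tsum (ha : ∀ i n, ‖a i n‖ ≤ M)
    (h : ∀ x ∈ Set.Ioo (0 : ℝ) 1, Tendsto (fun i => ∑' n, x ^ n • a i n) l (𝓝 0)) :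
    Tendsto (fun i => a i 0) l (𝓝 0) := by
  have htail : Tendsto (fun x : ℝ => x * ((1 - x)⁻¹ * M)) (𝓝[>] 0) (𝓝 0) := by
    have hc : ContinuousAt (fun x : ℝ => x * ((1 - x)⁻¹ * M)) 0 := by
      fun_prop (disch := norm_num)
    simpa using hc.tendsto.mono_left nhdsWithin_le_nhds
  refine NormedAddGroup.tendsto_nhds_zero.2 fun ε hε => ?_
  obtain ⟨x, hxε, hx⟩ := ((htail.eventually_lt_const (half_pos hε)).and
    (Ioo_mem_nhdsGT zero_lt_one)).exists
  filter_upwards [NormedAddGroup.tendsto_nhds_zero.1 (h x hx) _ (half_pos hε)] with i hi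
  calc ‖a i 0‖ = ‖∑' n, x ^ n • a i n - x • ∑' n, x ^ n • a i (n + 1)‖ := by
        rw [tsum_pow_smul_eq_add (ha i) hx.1.le hx.2, add_sub_cancel_right]
    _ ≤ ‖∑' n, x ^ n • a i n‖ + x * ‖∑' n, x ^ n • a i (n + 1)‖ := by
        refine (norm_sub_le _ _).trans_eq ?_
        rw [norm_smul, Real.norm_of_nonneg hx.1.le]
    _ ≤ ‖∑' n, x ^ n • a i n‖ + x * ((1 - x)⁻¹ * M) := by
        gcongr
        · exact hx.1.le
        · exact norm_tsum_pow_smul_le (fun n => ha i (n + 1)) hx.1.le hx.2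
    _ < ε := by linarith

theorem tendsto_zero_coeff_of_tendsto_tsum (ha : ∀ i n, ‖a i n‖ ≤ M)
    (h : ∀ x ∈ Set.Ioo (0 : ℝ) 1, Tendsto (fun i => ∑' n, x ^ n • a i n) l (𝓝 0)) (n : ℕ) :
    Tendsto (fun i => a i n) l (𝓝 0) := by
  induction n generalizing a with
  | zero => exact tendsto_zero_coeff_zero_of_tendsto_tsum ha h
  | succ _ ih =>
    refine ih (a := fun i n => a i (n + 1)) (fun i n => ha i (n + 1)) fun x hx => ?_
    have hsub := ((h x hx).sub (tendsto_zero_coeff_zero_of_tendsto_tsum ha h)).const_smul x⁻¹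
    rw [sub_zero, smul_zero] at hsub
    refine hsub.congr fun i => ?_
    rw [tsum_pow_smul_eq_add (ha i) hx.1.le hx.2, add_sub_cancel_left,
      inv_smul_smul₀ hx.1.ne']

theorem tendsto_coeff_of_tendsto_tsum {b : ℕ → E} {g : ℝ → E} {B : ℝ} (ha : ∀ i n, ‖a i n‖ ≤ M)
    (hb : ∀ n, ‖b n‖ ≤ B) (hg : ∀ x ∈ Set.Ioo (0 : ℝ) 1, HasSum (fun n => x ^ n • b n) (g x))
    (h : ∀ x ∈ Set.Ioo (0 : ℝ) 1, Tendsto (fun i => ∑' n, x ^ n • a i n) l (𝓝 (g x))) (n : ℕ) :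
    Tendsto (fun i => a i n) l (𝓝 (b n)) := by
  refine tendsto_sub_nhds_zero_iff.1 (tendsto_zero_coeff_of_tendsto_tsum (M := M + B)
    (fun i n => norm_sub_le_of_le (ha i n) (hb n)) (fun x hx => ?_) n)
  rw [← sub_self (g x)]
  refine ((h x hx).sub_const (g x)).congr fun i => ?_
  have hs : Summable fun n => x ^ n • a i n := .of_norm_bounded
    ((summable_geometric_of_lt_one hx.1.le hx.2).mul_right M) (norm_pow_smul_le (ha i) hx.1.le)
  simp only [smul_sub, hs.tsum_sub (hg x hx).summable, (hg x hx).tsum_eq]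

end CoefficientConvergence

section SincProduct

theorem norm_coeff_prod_one_sub_le {R ι : Type*} [SeminormedCommRing R] [NormOneClass R]
    (s : Finset ι) (c : ι → R) (n : ℕ) :
    ‖coeff n (∏ i ∈ s, (1 - C (c i) * X))‖ ≤ ∏ i ∈ s, (1 + ‖c i‖) := by
  induction s using Finset.cons_induction generalizing n with
  | empty => rcases n with _ | n <;> simp [coeff_one]
  | cons i s hi ih =>
    have hP : 0 ≤ ∏ i ∈ s, (1 + ‖c i‖) := by positivity
    rw [prod_cons, prod_cons, sub_mul, one_mul, map_sub, mul_assoc, coeff_C_mul]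
    refine (norm_sub_le_of_le (ih n) (norm_mul_le _ _)).trans ?_
    rw [add_mul, one_mul]
    gcongr
    rcases n with _ | n
    · simpa using hP
    · rw [coeff_succ_X_mul]
      exact ih n

theorem hasSum_pow_smul_coeff_prod_one_sub {R ι : Type*} [CommRing R] [TopologicalSpace R]
    (s : Finset ι) (c : ι → R) (x : R) :
    HasSum (fun n => x ^ n • coeff n (∏ i ∈ s, (1 - C (c i) * X))) (∏ i ∈ s, (1 - c i * x)) := by
  set p : Polynomial R := ∏ i ∈ s, (1 - Polynomial.C (c i) * Polynomial.X) with hp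
  have hcoe : (p : R⟦X⟧) = ∏ i ∈ s, (1 - C (c i) * X) := by
    rw [← Polynomial.coeToPowerSeries.ringHom_apply, hp, map_prod]
    simp
  have heval : ∏ i ∈ s, (1 - c i * x) = p.eval x := by simp [hp, Polynomial.eval_prod]
  rw [← hcoe, heval, Polynomial.eval_eq_sum_range]
  simp only [Polynomial.coeff_coe, smul_eq_mul, mul_comm (p.coeff _)]
  refine hasSum_sum_of_ne_finset_zero fun n hn => ?_
  rw [Polynomial.coeff_eq_zero_of_natDegree_lt (by simpa using hn), mul_zero]

/-- The coefficients of the power series `∑ n, sincCoeff n * x ^ n = sinc (π √x)`, which is the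
limit of `∏ m ∈ Icc 1 N, (1 - x / m ^ 2)` by Euler's product for the sine. -/
noncomputable def sincCoeff (n : ℕ) : ℝ := (-1) ^ n * Real.pi ^ (2 * n) / (2 * n + 1).factorial

theorem norm_sincCoeff_le (n : ℕ) : ‖sincCoeff n‖ ≤ Real.exp Real.pi := by
  calc ‖sincCoeff n‖ = Real.pi ^ (2 * n) / (2 * n + 1).factorial := by
        simp [sincCoeff, abs_of_pos Real.pi_pos]
    _ ≤ Real.pi ^ (2 * n) / (2 * n).factorial := by gcongr; lia
    _ ≤ Real.exp Real.pi := Real.pow_div_factorial_le_exp Real.pi Real.pi_pos.le _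

theorem sincCoeff_zero : sincCoeff 0 = 1 := by simp [sincCoeff]

theorem sincCoeff_succ (n : ℕ) :
    (2 * n + 2) * (2 * n + 3) * sincCoeff (n + 1) = -(Real.pi ^ 2 * sincCoeff n) := by
  have h : (2 * (n + 1) + 1).factorial = (2 * n + 3) * ((2 * n + 2) * (2 * n + 1).factorial) := rfl
  rw [sincCoeff, sincCoeff, h]
  push_cast
  field_simp
  ring

theorem hasSum_sincCoeff (y : ℝ) :
    HasSum (fun n => (y ^ 2) ^ n • sincCoeff n) (Real.sinc (Real.pi * y)) := by
  rcases eq_or_ne y 0 with rfl | hy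
  · have h (n : ℕ) (hn : n ≠ 0) : ((0 : ℝ) ^ 2) ^ n • sincCoeff n = 0 := by
      rw [zero_pow two_ne_zero, zero_pow hn, zero_smul]
    convert hasSum_single 0 h
    rw [mul_zero, Real.sinc_zero, pow_zero, one_smul, sincCoeff_zero]
  have hy' : Real.pi * y ≠ 0 := mul_ne_zero Real.pi_ne_zero hy
  rw [Real.sinc_of_ne_zero hy']
  refine ((Real.hasSum_sin (Real.pi * y)).div_const (Real.pi * y)).congr_fun fun n => ?_
  rw [sincCoeff, smul_eq_mul]
  field_simp
  ring

theorem tendsto_prod_one_sub_sinc (y : ℝ) :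
    Tendsto (fun N : ℕ => ∏ m ∈ Icc 1 N, (1 - (m : ℝ)⁻¹ ^ 2 * y ^ 2)) atTop
      (𝓝 (Real.sinc (Real.pi * y))) := by
  rcases eq_or_ne y 0 with rfl | hy
  · simp
  have hy' : Real.pi * y ≠ 0 := mul_ne_zero Real.pi_ne_zero hy
  rw [Real.sinc_of_ne_zero hy']
  refine ((Real.tendsto_euler_sin_prod y).div_const (Real.pi * y)).congr fun N => ?_
  rw [mul_div_cancel_left₀ _ hy', ← Ico_add_one_right_eq_Icc, prod_Ico_eq_prod_range]
  refine prod_congr rfl fun m _ => ?_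
  rw [add_comm 1 m, Nat.cast_add_one, inv_pow, inv_mul_eq_div]

theorem tendsto_coeff_prod_one_sub (n : ℕ) :
    Tendsto (fun N : ℕ => coeff n (∏ m ∈ Icc 1 N, (1 - C ((m : ℝ)⁻¹ ^ 2) * X))) atTop
      (𝓝 (sincCoeff n)) := by
  have hs : Summable fun m : ℕ => ‖(m : ℝ)⁻¹ ^ 2‖ := by simp
  have hbound (N n : ℕ) : ‖coeff n (∏ m ∈ Icc 1 N, (1 - C ((m : ℝ)⁻¹ ^ 2) * X))‖ ≤
      Real.exp (∑' m : ℕ, ‖(m : ℝ)⁻¹ ^ 2‖) :=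
    (norm_coeff_prod_one_sub_le _ _ n).trans <|
      (Real.prod_one_add_le_exp_sum _ fun _ => norm_nonneg _).trans <|
        Real.exp_le_exp.2 (hs.sum_le_tsum _ fun m _ => norm_nonneg _)
  refine tendsto_coeff_of_tendsto_tsum (g := fun x => Real.sinc (Real.pi * √x)) hbound
    norm_sincCoeff_le (fun x hx => ?_) (fun x hx => ?_) n
  · simpa only [Real.sq_sqrt hx.1.le] using hasSum_sincCoeff √x
  · simpa only [(hasSum_pow_smul_coeff_prod_one_sub _ _ x).tsum_eq, Real.sq_sqrt hx.1.le] using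
      tendsto_prod_one_sub_sinc √x

end SincProduct

section Recurrence

/-- The generating function `∑ n, E(2 * n, k) X ^ n` of the sums of multiple zeta values of even
arguments and depth `k`, with one power of `X` for every two units of weight. -/
noncomputable def evenMZVSeries (k : ℕ) : ℝ⟦X⟧ :=
  PowerSeries.mk fun n => evenMZVSum (2 * n) k

theorem coeff_evenMZVSeries_mul_sinc (n k : ℕ) :
    coeff n (evenMZVSeries k * PowerSeries.mk sincCoeff) =
      (-1) ^ k * (n.choose k : ℝ) * sincCoeff n := by
  have hprod := tendsto_finsetSum (antidiagonal n) fun p _ =>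
    (tendsto_evenMZVSum p.1 k).mul (tendsto_coeff_prod_one_sub p.2)
  simp only [← coeff_mul, coeff_sum_powersetCard_prod_geomTail_mul] at hprod
  rw [tendsto_nhds_unique ((tendsto_coeff_prod_one_sub n).const_mul _) hprod, coeff_mul]
  simp only [evenMZVSeries, coeff_mk]

theorem cast_choose_succ_right_eq {R : Type*} [CommRing R] (n k : ℕ) :
    (n.choose (k + 1) : R) * (k + 1) = n.choose k * (n - k) := by
  rcases le_or_gt k n with h | h
  · rw [← Nat.cast_sub h]
    exact_mod_cast congrArg (Nat.cast : ℕ → R) (Nat.choose_succ_right_eq n k)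
  · simp [Nat.choose_eq_zero_of_lt h, Nat.choose_eq_zero_of_lt (h.trans k.lt_succ_self)]

-- The series `S = ∑ n, sincCoeff n X ^ n` satisfies `4 X D² S + 6 D S + π² S = 0`, where `D` is the
-- derivative. Applying `D ^ k` relates three consecutive derivatives of `S`, and by
-- `coeff_evenMZVSeries_mul_sinc` these are `D ^ k S = (-1) ^ k k! X ^ (-k) evenMZVSeries k * S`.
theorem evenMZVSeries_recurrence (k : ℕ) :
    C ((k + 2) * (k + 1) : ℝ) * evenMZVSeries (k + 2) +
        C (Real.pi ^ 2 / 4) * (X * evenMZVSeries k) =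
      C ((k + 3 / 2) * (k + 1) : ℝ) * evenMZVSeries (k + 1) := by
  have hsinc : (PowerSeries.mk sincCoeff : ℝ⟦X⟧) ≠ 0 := fun h => by
    simpa [sincCoeff_zero] using congrArg (coeff 0) h
  refine mul_right_cancel₀ hsinc ?_
  ext n
  rw [add_mul]
  simp only [mul_assoc, map_add, coeff_C_mul, coeff_evenMZVSeries_mul_sinc]
  rcases n with _ | n
  · simp
  · rw [coeff_succ_X_mul, coeff_evenMZVSeries_mul_sinc]
    have hdiag : ((n + 1).choose (k + 1) : ℝ) * (k + 1) = (n + 1) * n.choose k := by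
      exact_mod_cast (Nat.add_one_mul_choose_eq n k).symm
    have hright := cast_choose_succ_right_eq (R := ℝ) (n + 1) (k + 1)
    push_cast at hright
    linear_combination (-1) ^ k * (k + 1) * sincCoeff (n + 1) * hright +
      (-1) ^ k * (n + 3 / 2) * sincCoeff (n + 1) * hdiag +
      (-1) ^ k * n.choose k / 4 * sincCoeff_succ n

theorem evenMZVSum_recurrence (n k : ℕ) :
    (k + 2) * (k + 1) * evenMZVSum (2 * (n + 1)) (k + 2) =
      (k + 3 / 2) * (k + 1) * evenMZVSum (2 * (n + 1)) (k + 1) -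
        Real.pi ^ 2 / 4 * evenMZVSum (2 * n) k := by
  have h := congrArg (coeff (n + 1)) (evenMZVSeries_recurrence k)
  simp only [map_add, coeff_C_mul, coeff_succ_X_mul, evenMZVSeries, coeff_mk] at h
  linarith

end Recurrence

section ClosedForm

theorem cast_choose_add_two_eq {R : Type*} [CommRing R] (m k : ℕ) :
    (k + 2) * (k + 1) * ((m + 2).choose (k + 2) : R) =
      (4 * k + 6) * (k + 1) * m.choose (k + 1) +
        (2 * k + 1 - m) * (2 * k + 2 - m) * m.choose k := by
  have hright := cast_choose_succ_right_eq (R := R) m k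
  have hdiag_succ : ((m + 1).choose (k + 1) : R) * (k + 1) = (m + 1) * m.choose k := by
    exact_mod_cast congrArg (Nat.cast : ℕ → R) (Nat.add_one_mul_choose_eq m k).symm
  have hdiag_add_two :
      ((m + 2).choose (k + 2) : R) * (k + 2) = (m + 2) * (m + 1).choose (k + 1) := by
    exact_mod_cast congrArg (Nat.cast : ℕ → R) (Nat.add_one_mul_choose_eq (m + 1) (k + 1)).symm
  linear_combination (k + 1) * hdiag_add_two + (m + 2) * hdiag_succ - (4 * k + 6) * hright

/-- The coefficient of `ζ(2 * n - 2 * j)` in the closed form of `E(2 * n, k)`. The subtraction in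
the binomial coefficient, which vanishes for `0 < k ≤ 2 * j`, is only meant for `j < k`. -/
noncomputable def evenMZVCoeff (k j : ℕ) : ℝ :=
  4 ^ (j + 1) * sincCoeff j * (2 * k - 2 * j - 1).choose k / 4 ^ k

theorem evenMZVCoeff_eq_zero {k j : ℕ} (hk : k ≠ 0) (hj : k ≤ 2 * j) : evenMZVCoeff k j = 0 := by
  rw [evenMZVCoeff, Nat.choose_eq_zero_of_lt (by lia), Nat.cast_zero, mul_zero, zero_div]

theorem evenMZVCoeff_zero_recurrence (k : ℕ) :
    (k + 2) * (k + 1) * evenMZVCoeff (k + 2) 0 =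
      (k + 3 / 2) * (k + 1) * evenMZVCoeff (k + 1) 0 := by
  have h := cast_choose_add_two_eq (R := ℝ) (2 * k + 1) k
  rw [evenMZVCoeff, evenMZVCoeff, show 2 * (k + 2) - 2 * 0 - 1 = 2 * k + 1 + 2 by lia,
    show 2 * (k + 1) - 2 * 0 - 1 = 2 * k + 1 by lia, sincCoeff_zero]
  push_cast at h
  linear_combination 4 / 4 ^ (k + 2) * h

theorem evenMZVCoeff_succ_recurrence {k j : ℕ} (hj : j < k) :
    (k + 2) * (k + 1) * evenMZVCoeff (k + 2) (j + 1) =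
      (k + 3 / 2) * (k + 1) * evenMZVCoeff (k + 1) (j + 1) -
        Real.pi ^ 2 / 4 * evenMZVCoeff k j := by
  obtain ⟨m, hm⟩ : ∃ m, 2 * k = m + 2 * j + 1 := ⟨2 * k - 2 * j - 1, by lia⟩
  have h := cast_choose_add_two_eq (R := ℝ) m k
  have hm' : (m : ℝ) = 2 * k - 2 * j - 1 := by
    have : (2 * k : ℝ) = m + 2 * j + 1 := by exact_mod_cast hm
    linarith
  rw [evenMZVCoeff, evenMZVCoeff, evenMZVCoeff, show 2 * (k + 2) - 2 * (j + 1) - 1 = m + 2 by lia,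
    show 2 * (k + 1) - 2 * (j + 1) - 1 = m by lia, show 2 * k - 2 * j - 1 = m by lia]
  rw [hm'] at h
  linear_combination 4 ^ (j + 2) / 4 ^ (k + 2) * sincCoeff (j + 1) * h +
    4 ^ j / 4 ^ k * m.choose k * sincCoeff_succ j

theorem sum_evenMZVCoeff_recurrence (k n : ℕ) (z : ℕ → ℝ) :
    (k + 2) * (k + 1) * ∑ j ∈ range (k + 2), evenMZVCoeff (k + 2) j * z (n + 1 - j) =
      (k + 3 / 2) * (k + 1) * ∑ j ∈ range (k + 1), evenMZVCoeff (k + 1) j * z (n + 1 - j) -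
        Real.pi ^ 2 / 4 * ∑ j ∈ range k, evenMZVCoeff k j * z (n - j) := by
  rw [sum_range_succ _ (k + 1), evenMZVCoeff_eq_zero (by lia) (by lia), zero_mul, add_zero,
    sum_range_succ', sum_range_succ']
  have htail : ((k : ℝ) + 2) * (k + 1) *
        ∑ j ∈ range k, evenMZVCoeff (k + 2) (j + 1) * z (n + 1 - (j + 1)) =
      (k + 3 / 2) * (k + 1) *
          ∑ j ∈ range k, evenMZVCoeff (k + 1) (j + 1) * z (n + 1 - (j + 1)) -
        Real.pi ^ 2 / 4 * ∑ j ∈ range k, evenMZVCoeff k j * z (n - j) := by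
    simp only [mul_sum, ← sum_sub_distrib, Nat.add_sub_add_right]
    refine sum_congr rfl fun j hj => ?_
    linear_combination z (n - j) * evenMZVCoeff_succ_recurrence (mem_range.1 hj)
  linear_combination htail + z (n + 1) * evenMZVCoeff_zero_recurrence k

theorem evenMZVSum_eq_sum {n k : ℕ} (hkn : k < 2 * n) :
    evenMZVSum (2 * n) k = ∑ j ∈ range k, evenMZVCoeff k j * evenMZVSum (2 * (n - j)) 1 := by
  induction k using Nat.twoStepInduction generalizing n with
  | zero => exact evenMZVSum_zero_depth hkn.ne'
  | one => simp [evenMZVCoeff, sincCoeff_zero]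
  | more k ih₀ ih₁ =>
    obtain ⟨n, rfl⟩ : ∃ m, n = m + 1 := ⟨n - 1, by lia⟩
    have hk : ((k : ℝ) + 2) * (k + 1) ≠ 0 := by positivity
    refine mul_left_cancel₀ hk ?_
    rw [evenMZVSum_recurrence, sum_evenMZVCoeff_recurrence k n fun m => evenMZVSum (2 * m) 1,
      ih₀ (by lia), ih₁ (by lia)]

theorem evenMZVSum_eq_add_sum_Icc {n k : ℕ} (hk : k ≠ 0) (hkn : k < 2 * n) :
    evenMZVSum (2 * n) k = evenMZVCoeff k 0 * evenMZVSum (2 * n) 1 +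
      ∑ j ∈ Icc 1 ((k - 1) / 2), evenMZVCoeff k j * evenMZVSum (2 * (n - j)) 1 := by
  have hsub : range ((k - 1) / 2 + 1) ⊆ range k := range_subset_range.2 (by lia)
  rw [evenMZVSum_eq_sum hkn, ← sum_subset hsub fun j _ hj => ?_, sum_range_eq_add_Ico _ (by lia),
    Ico_add_one_right_eq_Icc, tsub_zero]
  rw [evenMZVCoeff_eq_zero hk (by rw [mem_range] at hj; lia), zero_mul]

theorem evenMZVCoeff_zero_right {k : ℕ} (hk : k ≠ 0) :
    evenMZVCoeff k 0 = 1 / 2 ^ (2 * (k - 1)) * (2 * k - 1).choose k := by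
  have hpow : (4 : ℝ) ^ k = 4 * 2 ^ (2 * (k - 1)) := by
    rw [pow_mul, ← mul_pow_sub_one hk]
    norm_num
  rw [evenMZVCoeff, sincCoeff_zero, hpow, mul_zero, tsub_zero, zero_add, pow_one]
  field_simp

theorem sincCoeff_eq_riemannZeta {j : ℕ} (hj : j ≠ 0) :
    (sincCoeff j : ℂ) =
      -(2 * riemannZeta (2 * j) / (4 ^ j * (2 * j + 1) * (bernoulli (2 * j) : ℚ))) := by
  have hζ : riemannZeta (2 * j) ≠ 0 :=
    riemannZeta_ne_zero_of_one_le_re (by norm_cast; lia)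
  rw [riemannZeta_two_mul_nat hj] at hζ ⊢
  have hB : ((bernoulli (2 * j) : ℚ) : ℂ) ≠ 0 := fun h => hζ (by simp [h])
  have hpow : (4 : ℂ) ^ j = 2 * 2 ^ (2 * j - 1) := by
    rw [mul_pow_sub_one (by lia), pow_mul]
    norm_num
  have hodd : (2 * j + 1 : ℂ) ≠ 0 := by norm_cast
  rw [sincCoeff, Nat.factorial_succ, hpow]
  push_cast
  field_simp
  ring

theorem evenMZVCoeff_eq_riemannZeta {k j : ℕ} (hk : 2 ≤ k) (hj : j ≠ 0) :
    (evenMZVCoeff k j : ℂ) =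
      -(1 / (2 ^ (2 * k - 3) * (2 * (j : ℂ) + 1) * ((bernoulli (2 * j) : ℚ) : ℂ)) *
        ((2 * k - 2 * j - 1).choose k : ℂ) * riemannZeta (2 * (j : ℂ))) := by
  have hpow : (4 : ℂ) ^ k = 8 * 2 ^ (2 * k - 3) := by
    rw [show (4 : ℂ) = 2 ^ 2 by norm_num, show (8 : ℂ) = 2 ^ 3 by norm_num, ← pow_mul, ← pow_add,
      show 3 + (2 * k - 3) = 2 * k by lia]
  rw [evenMZVCoeff]
  push_cast
  rw [sincCoeff_eq_riemannZeta hj, hpow]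
  field_simp
  ring

end ClosedForm

-- For `n < k` the left-hand side is an empty sum, and this is a relation between `ζ(2 * n)` and the
-- products `ζ(2 * j) * ζ(2 * n - 2 * j)`.
theorem theorem1_general (n k : ℕ) (hk : 1 ≤ k) (hkn : k < 2 * n) :
    (∀ i ∈ evenArguments (2 * n) k, Summable (mzvTerm i)) ∧
    (evenMZVSum (2 * n) k : ℂ) =
      1 / 2 ^ (2 * (k - 1)) * (Nat.choose (2 * k - 1) k : ℂ) * riemannZeta (2 * (n : ℂ)) -
        ∑ j ∈ Finset.Icc 1 ((k - 1) / 2),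
          1 / (2 ^ (2 * k - 3) * (2 * (j : ℂ) + 1) * ((bernoulli (2 * j) : ℚ) : ℂ)) *
            (Nat.choose (2 * k - 2 * j - 1) k : ℂ) *
            riemannZeta (2 * (j : ℂ)) * riemannZeta (2 * (n : ℂ) - 2 * (j : ℂ)) := by
  refine ⟨fun i hi => summable_mzvTerm (one_lt_of_mem_evenArguments hi), ?_⟩
  have hk0 : k ≠ 0 := Nat.one_le_iff_ne_zero.1 hk
  rw [evenMZVSum_eq_add_sum_Icc hk0 hkn, evenMZVCoeff_zero_right hk0, sub_eq_add_neg,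
    ← sum_neg_distrib]
  push_cast
  rw [evenMZVSum_one_depth (by lia)]
  congr 1
  refine sum_congr rfl fun j hj => ?_
  obtain ⟨hj1, hjk⟩ := mem_Icc.1 hj
  rw [evenMZVCoeff_eq_riemannZeta (by lia) (by lia), evenMZVSum_one_depth (by lia),
    Nat.cast_sub (by lia), mul_sub, neg_mul]

theorem theorem1 (n k : ℕ) (hk : 1 ≤ k) (hkn : k ≤ n) :
    (∀ i ∈ evenArguments (2 * n) k, Summable (mzvTerm i)) ∧
    (evenMZVSum (2 * n) k : ℂ) =
      1 / 2 ^ (2 * (k - 1)) * (Nat.choose (2 * k - 1) k : ℂ) * riemannZeta (2 * (n : ℂ)) -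
        ∑ j ∈ Finset.Icc 1 ((k - 1) / 2),
          1 / (2 ^ (2 * k - 3) * (2 * (j : ℂ) + 1) * ((bernoulli (2 * j) : ℚ) : ℂ)) *
            (Nat.choose (2 * k - 2 * j - 1) k : ℂ) *
            riemannZeta (2 * (j : ℂ)) * riemannZeta (2 * (n : ℂ) - 2 * (j : ℂ)) :=
  theorem1_general n k hk (by lia)
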